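/- **Theorem (Finite-$n$ Probability Bound).** There are universal constants $c, C > 0$ such that the following holds. Let $n \ge 2$, let $\mathbf 1 \in \mathbb R^n$ be the all-ones vector, $\mathcal V_\perp = \mathbf 1^\perp$ and $\mathcal P_\perp = I_n - \frac1n \mathbf 1 \mathbf 1^\top$. Let $M \in \mathbb R^{n\times n}$ be a primitive doubly stochastic matrix, let $x_\perp, x'_\perp \in \mathcal V_\perp$, let $\nu > 0$, and let $\xi, \xi'$ be independent random vectors with law $\mathcal N(0, \frac{\nu^2}{n} I_n)$. Write $\mathrm{LN}(y) = \sqrt n\, \mathcal P_\perp y / \|\mathcal P_\perp y\|_2$ for layer normalization, and let $$u = \tfrac{1}{\sqrt n}\,\mathrm{LN}(M x_\perp + \xi), \qquad v = \tfrac{1}{\sqrt n}\,\mathrm{LN}(M x'_\perp + \xi')$$ be the normalized outputs, rescaled to unit length. (They are defined almost surely.) Let $$\gamma = \max\left(\frac{\|M x_\perp\|_2}{\mathbb E\,\|\mathcal P_\perp \xi\|_2},\ \frac{\|M x'_\perp\|_2}{\mathbb E\,\|\mathcal P_\perp \xi'\|_2}\right)$$ be the larger of the two signal-to-noise ratios,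 and assume $\gamma \le 1/8$. Then for all $\epsilon > 0$ and $\delta \in (0,1)$, $$\mathbb P\big( |\langle u, v\rangle| \le \epsilon + 8\gamma \big) \ \ge\ 1 - \delta - C e^{-c n \epsilon^2}.$$ -/

import Mathlib

open MeasureTheory ProbabilityTheory

noncomputable section

namespace Collapse

/-- The space `ℝⁿ` with its Euclidean norm and inner product. -/
abbrev Vec (n : ℕ) : Type := EuclideanSpace ℝ (Fin n)

/-- The all-ones vector `𝟏 ∈ ℝⁿ`. -/
def ones (n : ℕ) : Vec n := WithLp.toLp 2 (fun _ => (1 : ℝ))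

/-- The detail subspace `V_⊥ = 𝟏^⊥`. -/
def detailSubspace (n : ℕ) : Submodule ℝ (Vec n) := (Submodule.span ℝ {ones n})ᗮ

/-- The linear map of `ℝⁿ` given by an `n × n` matrix. -/
def act {n : ℕ} (A : Matrix (Fin n) (Fin n) ℝ) : Vec n →L[ℝ] Vec n :=
  Matrix.toEuclideanCLM (n := Fin n) (𝕜 := ℝ) A

/-- The projection onto the detail subspace, `P_⊥ = I - (1/n) 𝟏 𝟏ᵀ`. -/
def detailProj (n : ℕ) : Vec n →L[ℝ] Vec n :=
  act (1 - (1 / (n : ℝ)) • Matrix.of (fun _ _ => (1 : ℝ)))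

/-- Layer normalization without affine parameters, `LN(y) = √n • P_⊥ y / ‖P_⊥ y‖`. -/
def layerNorm {n : ℕ} (y : Vec n) : Vec n :=
  (Real.sqrt n / ‖detailProj n y‖) • detailProj n y

/-- The normalized output for the detail component `x` and the noise value `z`: the layer
normalization of `y = M x + z`, rescaled from radius `√n` to the unit sphere. -/
def normalizedOutput {n : ℕ} (M : Matrix (Fin n) (Fin n) ℝ) (x z : Vec n) : Vec n :=
  (Real.sqrt n)⁻¹ • layerNorm (act M x + z)

/-- The signal-to-noise ratio `‖M x‖ / 𝔼 ‖P_⊥ ξ‖` of the detail component `x` under the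
noise `ξ`. -/
def snr {Ω : Type*} [MeasurableSpace Ω] (P : Measure Ω) {n : ℕ}
    (M : Matrix (Fin n) (Fin n) ℝ) (x : Vec n) (ξ : Ω → Vec n) : ℝ :=
  ‖act M x‖ / ∫ ω, ‖detailProj n (ξ ω)‖ ∂P

/-- The isotropic Gaussian law `N(0, (ν² / n) Iₙ)`. -/
def noiseLaw (n : ℕ) (ν : ℝ) : Measure (Vec n) :=
  multivariateGaussian 0 ((ν ^ 2 / (n : ℝ)) • (1 : Matrix (Fin n) (Fin n) ℝ))

end Collapse

end

/-!
Projecting onto `𝟏^⊥` and dividing by the noise level `ν / √n` turns the two inputs into `a + ζ`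
and `b + ζ'`, where `ζ` and `ζ'` are independent standard Gaussian vectors in dimension
`d = n - 1`. Since `𝔼 ‖ζ‖ ≤ √d`, the signals satisfy `‖a‖, ‖b‖ ≤ γ √d`. Outside an event of
probability at most `2 exp (-d / 8)` both `‖ζ‖` and `‖ζ'‖` exceed `√d / 2`, and then adding the
signal moves each direction by at most `2 ‖a‖ / ‖ζ‖ ≤ 4 γ`. Conditionally on `ζ`, the inner
product of `ζ / ‖ζ‖` with `ζ'` is sub-Gaussian with variance proxy `1`, so it exceeds `ε √d / 2`
with probability at most `2 exp (-d ε² / 8)`. For `ε > 1` there is nothing to prove, for `ε ≤ 1`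
the errors sum to at most `4 exp (-d ε² / 8)`, and `d ≥ n / 2`.
-/

namespace Collapse

open Module NormedSpace
open scoped NNReal RealInnerProductSpace

section Normalize

variable {E : Type*} [NormedAddCommGroup E]

section RealNormedSpace

variable [NormedSpace ℝ E]

lemma norm_normalize_le_one (x : E) : ‖normalize x‖ ≤ 1 := by
  rw [NormedSpace.normalize, norm_smul, norm_inv, norm_norm]
  exact inv_mul_le_one

lemma norm_normalize_add_sub_normalize_le (a : E) {g : E} (hg : g ≠ 0) :
    ‖normalize (a + g) - normalize g‖ ≤ 2 * ‖a‖ / ‖g‖ := by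
  have hrescale : ‖g‖ • (normalize (a + g) - normalize g) =
      (‖g‖ - ‖a + g‖) • normalize (a + g) + a := by
    rw [sub_smul, smul_sub, norm_smul_normalize, norm_smul_normalize]
    abel
  have hradius : ‖‖g‖ - ‖a + g‖‖ ≤ ‖a‖ := by
    simpa using abs_norm_sub_norm_le g (a + g)
  rw [le_div_iff₀' (norm_pos_iff.2 hg)]
  calc ‖g‖ * ‖normalize (a + g) - normalize g‖
      = ‖(‖g‖ - ‖a + g‖) • normalize (a + g) + a‖ := by
        rw [← hrescale, norm_smul, norm_norm]
    _ ≤ ‖‖g‖ - ‖a + g‖‖ * ‖normalize (a + g)‖ + ‖a‖ := by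
        rw [← norm_smul]
        exact norm_add_le _ _
    _ ≤ ‖a‖ * 1 + ‖a‖ := by
        gcongr
        exact norm_normalize_le_one _
    _ = 2 * ‖a‖ := by ring

lemma normalize_coe (K : Submodule ℝ E) (y : K) :
    normalize (y : E) = (normalize y : K) := rfl

lemma measurable_normalize [SecondCountableTopology E] [MeasurableSpace E] [BorelSpace E] :
    Measurable (normalize : E → E) := by
  unfold NormedSpace.normalize
  fun_prop

end RealNormedSpace

variable [InnerProductSpace ℝ E]

lemma abs_inner_normalize_le_one (x y : E) : |⟪normalize x, normalize y⟫| ≤ 1 :=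
  (abs_real_inner_le_norm _ _).trans <|
    mul_le_one₀ (norm_normalize_le_one x) (norm_nonneg _) (norm_normalize_le_one y)

lemma abs_inner_normalize_add_le (a b : E) {g h : E} (hg : g ≠ 0) (hh : h ≠ 0) :
    |⟪normalize (a + g), normalize (b + h)⟫| ≤
      |⟪normalize g, normalize h⟫| + 2 * ‖a‖ / ‖g‖ + 2 * ‖b‖ / ‖h‖ := by
  have hsplit : ⟪normalize (a + g), normalize (b + h)⟫ = ⟪normalize g, normalize h⟫ +
      ⟪normalize (a + g) - normalize g, normalize (b + h)⟫ +
      ⟪normalize g, normalize (b + h) - normalize h⟫ := by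
    rw [inner_sub_left, inner_sub_right]
    ring
  have hleft : |⟪normalize (a + g) - normalize g, normalize (b + h)⟫| ≤ 2 * ‖a‖ / ‖g‖ :=
    (abs_real_inner_le_norm _ _).trans <|
      (mul_le_of_le_one_right (norm_nonneg _) (norm_normalize_le_one _)).trans
        (norm_normalize_add_sub_normalize_le a hg)
  have hright : |⟪normalize g, normalize (b + h) - normalize h⟫| ≤ 2 * ‖b‖ / ‖h‖ :=
    (abs_real_inner_le_norm _ _).trans <|
      (mul_le_of_le_one_left (norm_nonneg _) (norm_normalize_le_one _)).trans
        (norm_normalize_add_sub_normalize_le b hh)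
  rw [hsplit]
  exact (abs_add_three _ _ _).trans (by gcongr)

lemma abs_inner_normalize_add_le_of_le_norm {a b g h : E} {ε r ρ : ℝ} (hr : 0 < r)
    (ha : ‖a‖ ≤ ρ * r) (hb : ‖b‖ ≤ ρ * r) (hg : r ≤ ‖g‖) (hh : r ≤ ‖h‖)
    (hgh : |⟪normalize g, h⟫| ≤ ε * r) :
    |⟪normalize (a + g), normalize (b + h)⟫| ≤ ε + 4 * ρ := by
  have hratio {x y : E} (hx : ‖x‖ ≤ ρ * r) (hy : r ≤ ‖y‖) : 2 * ‖x‖ / ‖y‖ ≤ 2 * ρ := by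
    have hρ : 0 ≤ ρ := nonneg_of_mul_nonneg_left ((norm_nonneg x).trans hx) hr
    rw [mul_div_assoc]
    gcongr
    exact div_le_of_le_mul₀ (norm_nonneg y) hρ (hx.trans (by gcongr))
  have hdir : |⟪normalize g, normalize h⟫| ≤ ε := by
    rw [NormedSpace.normalize, NormedSpace.normalize, real_inner_smul_right, abs_mul,
      abs_of_nonneg (by positivity), ← div_eq_inv_mul]
    calc |⟪normalize g, h⟫| / ‖h‖ ≤ |⟪normalize g, h⟫| / r := by gcongr
      _ ≤ ε := (div_le_iff₀ hr).2 hgh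
  linarith [abs_inner_normalize_add_le a b (norm_pos_iff.1 (hr.trans_le hg))
    (norm_pos_iff.1 (hr.trans_le hh)), hratio ha hg, hratio hb hh]

end Normalize

section StdGaussian

lemma mgf_sq_gaussianReal {t : ℝ} (ht : t < 1 / 2) :
    mgf (fun x ↦ x ^ 2) (gaussianReal 0 1) t = (√(1 - 2 * t))⁻¹ := by
  have hdensity (x : ℝ) : gaussianPDFReal 0 1 x • Real.exp (t * x ^ 2) =
      (√(2 * Real.pi))⁻¹ * Real.exp (-(1 / 2 - t) * x ^ 2) := by
    rw [gaussianPDFReal, smul_eq_mul, mul_assoc, ← Real.exp_add]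
    simp only [NNReal.coe_one, sub_zero, mul_one]
    ring_nf
  have hscale : Real.pi / (1 / 2 - t) = 2 * Real.pi / (1 - 2 * t) := by
    have : 1 / 2 - t ≠ 0 := by linarith
    have : 1 - 2 * t ≠ 0 := by linarith
    field_simp
  rw [mgf, integral_gaussianReal_eq_integral_smul one_ne_zero]
  simp_rw [hdensity]
  rw [integral_const_mul, integral_gaussian, hscale, Real.sqrt_div (by positivity),
    ← div_eq_inv_mul, div_right_comm, div_self (by positivity), one_div]

variable {E : Type*} [NormedAddCommGroup E] [InnerProductSpace ℝ E] [FiniteDimensional ℝ E]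
  [MeasurableSpace E] [BorelSpace E]

lemma mgf_norm_sq_stdGaussian {t : ℝ} (ht : t < 1 / 2) :
    mgf (fun z ↦ ‖z‖ ^ 2) (stdGaussian E) t = (√(1 - 2 * t))⁻¹ ^ finrank ℝ E := by
  have hprod (x : Fin (finrank ℝ E) → ℝ) :
      Real.exp (t * ‖∑ i, x i • stdOrthonormalBasis ℝ E i‖ ^ 2) =
        ∏ i, Real.exp (t * x i ^ 2) := by
    rw [← (stdOrthonormalBasis ℝ E).sum_sq_inner_right, Finset.mul_sum, Real.exp_sum]
    simp_rw [(stdOrthonormalBasis ℝ E).orthonormal.inner_right_fintype]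
  rw [mgf, stdGaussian, integral_map (Measurable.aemeasurable (by fun_prop)) (by fun_prop)]
  simp_rw [hprod]
  rw [integral_fintype_prod_eq_pow (fun x : ℝ ↦ Real.exp (t * x ^ 2)), Fintype.card_fin]
  exact congrArg (· ^ _) (mgf_sq_gaussianReal ht)

/- The Chernoff bound at parameter `-1/2` gives `exp (d / 8) * 2 ^ (-d / 2)`. -/
lemma measureReal_norm_stdGaussian_le :
    (stdGaussian E).real {z | ‖z‖ ≤ √(finrank ℝ E) / 2} ≤
      Real.exp (-(finrank ℝ E / 8)) := by
  set d := finrank ℝ E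
  have hball : {z : E | ‖z‖ ≤ √d / 2} = {z | ‖z‖ ^ 2 ≤ (d : ℝ) / 4} := by
    ext z
    rw [Set.mem_ofPred_eq, Set.mem_ofPred_eq, ← sq_le_sq₀ (norm_nonneg z) (by positivity), div_pow,
      Real.sq_sqrt (by positivity)]
    norm_num
  have hint : Integrable (fun z : E ↦ Real.exp (-(1 / 2) * ‖z‖ ^ 2)) (stdGaussian E) := by
    refine .of_bound (by fun_prop) 1 (.of_forall fun z ↦ ?_)
    rw [Real.norm_of_nonneg (Real.exp_nonneg _), Real.exp_le_one_iff]
    nlinarith [sq_nonneg ‖z‖]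
  have hmgf : mgf (fun z ↦ ‖z‖ ^ 2) (stdGaussian E) (-(1 / 2)) = (√2)⁻¹ ^ d := by
    rw [mgf_norm_sq_stdGaussian (by norm_num)]
    norm_num [d]
  have hsqrt : (√2)⁻¹ ≤ Real.exp (-(1 / 4)) := by
    rw [Real.exp_neg]
    gcongr
    refine Real.le_sqrt_of_sq_le ?_
    rw [← Real.exp_nat_mul, ← Real.le_log_iff_exp_le (by norm_num)]
    linarith [Real.log_two_gt_d9]
  calc (stdGaussian E).real {z | ‖z‖ ≤ √d / 2}
      ≤ Real.exp (-(-(1 / 2)) * (d / 4)) * mgf (fun z ↦ ‖z‖ ^ 2) (stdGaussian E) (-(1 / 2)) :=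
        hball ▸ measure_le_le_exp_mul_mgf _ (by norm_num) hint
    _ = Real.exp (d / 8) * (√2)⁻¹ ^ d := by
        rw [hmgf]
        ring_nf
    _ ≤ Real.exp (d / 8) * Real.exp (-(1 / 4)) ^ d := by gcongr
    _ = Real.exp (-(d / 8)) := by
        rw [← Real.exp_nat_mul, ← Real.exp_add]
        ring_nf

lemma integral_inner_sq_stdGaussian (w : E) : ∫ z, ⟪w, z⟫ ^ 2 ∂(stdGaussian E) = ‖w‖ ^ 2 := by
  have hvar := variance_dual_stdGaussian (innerSL ℝ w)
  rwa [variance_of_integral_eq_zero (by fun_prop) (integral_strongDual_stdGaussian _),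
    innerSL_apply_norm] at hvar

lemma integral_norm_sq_stdGaussian : ∫ z, ‖z‖ ^ 2 ∂(stdGaussian E) = finrank ℝ E := by
  set b := stdOrthonormalBasis ℝ E
  have hint (i) : Integrable (fun z ↦ ⟪b i, z⟫ ^ 2) (stdGaussian E) :=
    ((innerSL ℝ (b i)).comp_memLp' IsGaussian.memLp_two_id).integrable_sq
  calc ∫ z, ‖z‖ ^ 2 ∂(stdGaussian E) = ∫ z, ∑ i, ⟪b i, z⟫ ^ 2 ∂(stdGaussian E) := by
        simp_rw [b.sum_sq_inner_right]
    _ = ∑ i, ‖b i‖ ^ 2 := by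
        rw [integral_finsetSum _ fun i _ ↦ hint i]
        simp_rw [integral_inner_sq_stdGaussian]
    _ = finrank ℝ E := by simp

lemma integral_norm_stdGaussian_le : ∫ z, ‖z‖ ∂(stdGaussian E) ≤ √(finrank ℝ E) := by
  have hnorm : MemLp (fun z ↦ ‖z‖) 2 (stdGaussian E) := IsGaussian.memLp_two_id.norm
  have hvar := variance_nonneg (fun z ↦ ‖z‖) (stdGaussian E)
  rw [variance_eq_sub hnorm] at hvar
  refine Real.le_sqrt_of_sq_le ?_
  rw [← integral_norm_sq_stdGaussian (E := E)]
  exact sub_nonneg.1 hvar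

lemma integral_norm_stdGaussian_pos [Nontrivial E] : 0 < ∫ z, ‖z‖ ∂(stdGaussian E) := by
  refine (integral_nonneg fun z ↦ norm_nonneg z).lt_of_ne' fun hzero ↦ ?_
  rw [integral_eq_zero_iff_of_nonneg (fun z ↦ norm_nonneg z)
    IsGaussian.integrable_id.norm] at hzero
  have hsq : ∫ z : E, ‖z‖ ^ 2 ∂(stdGaussian E) = 0 :=
    integral_eq_zero_of_ae <| hzero.mono fun z (hz : ‖z‖ = 0) ↦ by simp [hz]
  rw [integral_norm_sq_stdGaussian, Nat.cast_eq_zero] at hsq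
  exact finrank_pos.ne' hsq

lemma map_orthogonalProjectionOnto_stdGaussian (K : Submodule ℝ E) :
    (stdGaussian E).map K.orthogonalProjectionOnto = stdGaussian K := by
  refine Measure.ext_of_charFun (funext fun t ↦ ?_)
  rw [charFun_apply, integral_map (by fun_prop) (by fun_prop)]
  simp_rw [Submodule.inner_orthogonalProjectionOnto_eq_of_mem_right]
  rw [← charFun_apply, charFun_stdGaussian, charFun_stdGaussian, Submodule.coe_norm]

lemma hasSubgaussianMGF_inner_stdGaussian {w : E} {c : ℝ≥0} (hw : ‖w‖ ^ 2 ≤ c) :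
    HasSubgaussianMGF (fun z ↦ ⟪w, z⟫) c (stdGaussian E) := by
  have hmap : (stdGaussian E).map (fun z ↦ ⟪w, z⟫) = gaussianReal 0 (‖w‖ ^ 2).toNNReal := by
    have h := IsGaussian.map_eq_gaussianReal (μ := stdGaussian E) (innerSL ℝ w)
    rwa [variance_dual_stdGaussian, integral_strongDual_stdGaussian, innerSL_apply_norm] at h
  refine ⟨fun t ↦ ?_, fun t ↦ ?_⟩
  · have hint := integrable_exp_mul_gaussianReal (μ := 0) (v := (‖w‖ ^ 2).toNNReal) t
    rw [← hmap] at hint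
    exact hint.comp_measurable (by fun_prop)
  · rw [mgf_gaussianReal hmap, zero_mul, zero_add, Real.coe_toNNReal _ (by positivity)]
    gcongr

end StdGaussian

section RandomVectors

variable {Ω : Type*} [MeasurableSpace Ω] {P : Measure Ω}

lemma measureReal_abs_ge_le_of_hasSubgaussianMGF {X : Ω → ℝ} {c : ℝ≥0}
    (hX : HasSubgaussianMGF X c P) {s : ℝ} (hs : 0 ≤ s) :
    P.real {ω | s ≤ |X ω|} ≤ 2 * Real.exp (-s ^ 2 / (2 * c)) := by
  have hunion : {ω | s ≤ |X ω|} = {ω | s ≤ X ω} ∪ {ω | s ≤ (-X) ω} := by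
    ext ω
    exact le_abs (b := X ω)
  rw [hunion, two_mul]
  exact (measureReal_union_le _ _).trans
    (add_le_add (hX.measure_ge_le hs) (hX.neg.measure_ge_le hs))

variable {E : Type*} [NormedAddCommGroup E] [InnerProductSpace ℝ E] [FiniteDimensional ℝ E]
  [MeasurableSpace E] [BorelSpace E]

lemma measureReal_abs_inner_ge_le_of_indepFun [IsProbabilityMeasure P] {Y ζ : Ω → E} {c : ℝ≥0}
    (hY : AEMeasurable Y P) (hYc : ∀ᵐ ω ∂P, ‖Y ω‖ ^ 2 ≤ c) (hζ : HasLaw ζ (stdGaussian E) P)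
    (hind : IndepFun Y ζ P) {s : ℝ} (hs : 0 ≤ s) :
    P.real {ω | s ≤ |⟪Y ω, ζ ω⟫|} ≤ 2 * Real.exp (-s ^ 2 / (2 * c)) := by
  have := Measure.isProbabilityMeasure_map hY
  have hlaw : HasLaw (fun ω ↦ (Y ω, ζ ω)) ((P.map Y).prod (stdGaussian E)) P :=
    (indepFun_iff_hasLaw_prodMk_prod ⟨hY, rfl⟩ hζ).1 hind
  have hmeas : MeasurableSet {p : E × E | s ≤ |⟪p.1, p.2⟫|} :=
    measurableSet_le measurable_const (by fun_prop)
  have hYc' : ∀ᵐ y ∂(P.map Y), ‖y‖ ^ 2 ≤ c :=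
    (ae_map_iff hY (measurableSet_le (by fun_prop) measurable_const)).2 hYc
  rw [hlaw.measureReal_eq (p := fun p : E × E ↦ s ≤ |⟪p.1, p.2⟫|) hmeas]
  refine ENNReal.toReal_le_of_le_ofReal (by positivity) ?_
  calc ((P.map Y).prod (stdGaussian E)) {p | s ≤ |⟪p.1, p.2⟫|}
      = ∫⁻ y, stdGaussian E {z | s ≤ |⟪y, z⟫|} ∂(P.map Y) := Measure.prod_apply hmeas
    _ ≤ ∫⁻ _, ENNReal.ofReal (2 * Real.exp (-s ^ 2 / (2 * c))) ∂(P.map Y) := by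
        refine lintegral_mono_ae (hYc'.mono fun y hy ↦ ?_)
        rw [ENNReal.le_ofReal_iff_toReal_le (measure_ne_top _ _) (by positivity)]
        exact measureReal_abs_ge_le_of_hasSubgaussianMGF
          (hasSubgaussianMGF_inner_stdGaussian hy) hs
    _ = ENNReal.ofReal (2 * Real.exp (-s ^ 2 / (2 * c))) := by simp

lemma measureReal_norm_le_of_hasLaw_stdGaussian {ζ : Ω → E} (hζ : HasLaw ζ (stdGaussian E) P) :
    P.real {ω | ‖ζ ω‖ ≤ √(finrank ℝ E) / 2} ≤ Real.exp (-(finrank ℝ E / 8)) :=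
  (hζ.measureReal_eq (measurableSet_le (by fun_prop) measurable_const)).trans_le
    measureReal_norm_stdGaussian_le

lemma measureReal_abs_inner_normalize_ge_le [IsProbabilityMeasure P] {ζ ζ' : Ω → E}
    (hζ : AEMeasurable ζ P) (hζ' : HasLaw ζ' (stdGaussian E) P) (hind : IndepFun ζ ζ' P)
    {s : ℝ} (hs : 0 ≤ s) :
    P.real {ω | s ≤ |⟪normalize (ζ ω), ζ' ω⟫|} ≤ 2 * Real.exp (-s ^ 2 / 2) := by
  have hnorm (ω : Ω) : ‖normalize (ζ ω)‖ ^ 2 ≤ (1 : ℝ≥0) :=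
    pow_le_one₀ (norm_nonneg _) (norm_normalize_le_one _)
  simpa using measureReal_abs_inner_ge_le_of_indepFun (measurable_normalize.comp_aemeasurable hζ)
    (.of_forall hnorm) hζ' (hind.comp measurable_normalize measurable_id) hs

lemma one_sub_le_measureReal_abs_inner_normalize_add_le_of_pos [IsProbabilityMeasure P]
    {ζ ζ' : Ω → E} (hζ : AEMeasurable ζ P) (hζ' : HasLaw ζ' (stdGaussian E) P)
    (hind : IndepFun ζ ζ' P) {a b : E} {ε r ρ : ℝ} (hε : 0 ≤ ε) (hr : 0 < r)
    (ha : ‖a‖ ≤ ρ * r) (hb : ‖b‖ ≤ ρ * r) :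
    1 - (P.real {ω | ‖ζ ω‖ ≤ r} + P.real {ω | ‖ζ' ω‖ ≤ r} + 2 * Real.exp (-(ε * r) ^ 2 / 2)) ≤
      P.real {ω | |⟪normalize (a + ζ ω), normalize (b + ζ' ω)⟫| ≤ ε + 4 * ρ} := by
  set good := {ω | |⟪normalize (a + ζ ω), normalize (b + ζ' ω)⟫| ≤ ε + 4 * ρ}
  set small := {ω | ‖ζ ω‖ ≤ r}
  set small' := {ω | ‖ζ' ω‖ ≤ r}
  set aligned := {ω | ε * r ≤ |⟪normalize (ζ ω), ζ' ω⟫|}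
  have hcover : Set.univ ⊆ good ∪ (small ∪ small' ∪ aligned) := by
    intro ω _
    by_contra hω
    simp only [small, small', aligned, Set.mem_union, Set.mem_ofPred_eq, not_or, not_le] at hω
    obtain ⟨hbad, ⟨hsmall, hsmall'⟩, haligned⟩ := hω
    exact hbad <|
      abs_inner_normalize_add_le_of_le_norm hr ha hb hsmall.le hsmall'.le haligned.le
  have haligned : P.real aligned ≤ 2 * Real.exp (-(ε * r) ^ 2 / 2) :=
    measureReal_abs_inner_normalize_ge_le hζ hζ' hind (by positivity)
  have htotal : 1 ≤ P.real good + (P.real small + P.real small' + P.real aligned) := by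
    rw [← probReal_univ (μ := P)]
    refine (measureReal_mono hcover).trans ((measureReal_union_le _ _).trans ?_)
    gcongr
    refine (measureReal_union_le _ _).trans ?_
    gcongr
    exact measureReal_union_le _ _
  linarith

lemma one_sub_le_measureReal_abs_inner_normalize_add_le [IsProbabilityMeasure P] [Nontrivial E]
    {ζ ζ' : Ω → E} (hζ : HasLaw ζ (stdGaussian E) P) (hζ' : HasLaw ζ' (stdGaussian E) P)
    (hind : IndepFun ζ ζ' P) {a b : E} {ε ρ : ℝ} (hε : 0 ≤ ε)
    (ha : ‖a‖ ≤ ρ * √(finrank ℝ E)) (hb : ‖b‖ ≤ ρ * √(finrank ℝ E)) :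
    1 - 4 * Real.exp (-(finrank ℝ E * ε ^ 2 / 8)) ≤
      P.real {ω | |⟪normalize (a + ζ ω), normalize (b + ζ' ω)⟫| ≤ ε + 8 * ρ} := by
  have hd : (0 : ℝ) < finrank ℝ E := by exact_mod_cast finrank_pos
  rcases le_or_gt ε 1 with hε1 | hε1
  · have hsmall_le : Real.exp (-(finrank ℝ E / 8)) ≤
        Real.exp (-(finrank ℝ E * ε ^ 2 / 8)) := by
      gcongr
      exact mul_le_of_le_one_right hd.le (pow_le_one₀ hε hε1)
    have hexp : -(ε * (√(finrank ℝ E) / 2)) ^ 2 / 2 = -(finrank ℝ E * ε ^ 2 / 8) := by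
      rw [mul_pow, div_pow, Real.sq_sqrt hd.le]
      ring
    have hfour : 4 * (2 * ρ) = 8 * ρ := by ring
    have hlower := one_sub_le_measureReal_abs_inner_normalize_add_le_of_pos hζ.aemeasurable hζ'
      hind (a := a) (b := b) (r := √(finrank ℝ E) / 2) (ρ := 2 * ρ) hε (by positivity)
      (by linarith) (by linarith)
    rw [hexp, hfour] at hlower
    linarith [measureReal_norm_le_of_hasLaw_stdGaussian hζ,
      measureReal_norm_le_of_hasLaw_stdGaussian hζ']
  · have hρ : 0 ≤ ρ :=
      nonneg_of_mul_nonneg_left ((norm_nonneg a).trans ha) (Real.sqrt_pos.2 hd)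
    have hsure (ω : Ω) : |⟪normalize (a + ζ ω), normalize (b + ζ' ω)⟫| ≤ ε + 8 * ρ :=
      (abs_inner_normalize_le_one _ _).trans (le_add_of_le_of_nonneg hε1.le (by positivity))
    simp only [hsure, Set.ofPred_true, probReal_univ]
    exact sub_le_self _ (by positivity)

end RandomVectors

section Model

variable {n : ℕ}

lemma detailProj_eq_starProjection : detailProj n = (detailSubspace n).starProjection := by
  have hnorm : ‖ones n‖ ^ 2 = n := by
    simp [ones, EuclideanSpace.real_norm_sq_eq]
  ext y i
  rw [detailSubspace, Submodule.starProjection_orthogonal, sub_apply,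
    Submodule.starProjection_singleton, RCLike.ofReal_real_eq_id, id_eq, hnorm]
  simp [detailProj, act, ones, Matrix.mulVec, dotProduct, PiLp.inner_apply,
    Finset.mul_sum, div_eq_inv_mul]

lemma finrank_detailSubspace_add_one (hn : n ≠ 0) : finrank ℝ (detailSubspace n) + 1 = n := by
  have hones : ones n ≠ 0 := by
    intro h
    simpa [ones] using congrArg (fun y : Vec n ↦ y ⟨0, Nat.pos_of_ne_zero hn⟩) h
  have h := (Submodule.span ℝ {ones n}).finrank_add_finrank_orthogonal
  rw [finrank_span_singleton hones, finrank_euclideanSpace_fin] at h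
  rw [detailSubspace, add_comm, h]

lemma normalizedOutput_eq_normalize (hn : n ≠ 0) (M : Matrix (Fin n) (Fin n) ℝ) (x z : Vec n) :
    normalizedOutput M x z = normalize (detailProj n (act M x + z)) := by
  have hsqrt : √(n : ℝ) ≠ 0 := by positivity
  rw [normalizedOutput, layerNorm, smul_smul, ← mul_div_assoc, inv_mul_cancel₀ hsqrt, one_div,
    NormedSpace.normalize]

lemma multivariateGaussian_sq_smul_one {ι : Type*} [Fintype ι] [DecidableEq ι]
    (μ : EuclideanSpace ℝ ι) {s : ℝ} (hs : 0 ≤ s) :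
    multivariateGaussian μ (s ^ 2 • (1 : Matrix ι ι ℝ)) =
      (stdGaussian (EuclideanSpace ℝ ι)).map (fun z ↦ μ + s • z) := by
  open scoped MatrixOrder in
  have hsqrt : CFC.sqrt (s ^ 2 • (1 : Matrix ι ι ℝ)) = s • 1 :=
    CFC.sqrt_unique (by simp [smul_smul, sq])
      (Matrix.nonneg_iff_posSemidef.2 (Matrix.PosSemidef.one.smul hs))
  simp [multivariateGaussian, hsqrt]

lemma noiseLaw_eq_map_stdGaussian {ν : ℝ} (hν : 0 ≤ ν) :
    noiseLaw n ν = (stdGaussian (Vec n)).map (fun z ↦ (ν / √n) • z) := by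
  have hvar : ν ^ 2 / (n : ℝ) = (ν / √n) ^ 2 := by rw [div_pow, Real.sq_sqrt (by positivity)]
  rw [noiseLaw, hvar, multivariateGaussian_sq_smul_one 0 (by positivity)]
  simp_rw [zero_add]

/-- The detail component of a vector, as an element of the `(n - 1)`-dimensional space `V_⊥` and
in units of the noise level `ν / √n`, so that the noise becomes a standard Gaussian vector. -/
noncomputable def scaledDetail (n : ℕ) (ν : ℝ) : Vec n →L[ℝ] detailSubspace n :=
  (ν / √n)⁻¹ • (detailSubspace n).orthogonalProjectionOnto

variable {ν : ℝ}

lemma detailProj_eq_smul_scaledDetail (hn : n ≠ 0) (hν : ν ≠ 0) (y : Vec n) :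
    detailProj n y = (ν / √n) • (scaledDetail n ν y : Vec n) := by
  have hscale : ν / √n ≠ 0 := by positivity
  rw [detailProj_eq_starProjection, scaledDetail, smul_apply,
    Submodule.coe_smul, smul_inv_smul₀ hscale, Submodule.starProjection_apply]

lemma norm_scaledDetail_le (hν : 0 ≤ ν) (y : Vec n) :
    ‖scaledDetail n ν y‖ ≤ ‖y‖ / (ν / √n) := by
  rw [scaledDetail, smul_apply, norm_smul,
    Real.norm_of_nonneg (by positivity), div_eq_inv_mul ‖y‖]
  gcongr
  exact Submodule.norm_orthogonalProjectionOnto_apply_le _ y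

lemma inner_normalizedOutput_normalizedOutput (hn : n ≠ 0) (hν : 0 < ν)
    (M M' : Matrix (Fin n) (Fin n) ℝ) (x x' z z' : Vec n) :
    ⟪normalizedOutput M x z, normalizedOutput M' x' z'⟫ =
      ⟪normalize (scaledDetail n ν (act M x) + scaledDetail n ν z),
        normalize (scaledDetail n ν (act M' x') + scaledDetail n ν z')⟫ := by
  have hscale : 0 < ν / √n := by positivity
  simp only [normalizedOutput_eq_normalize hn, detailProj_eq_smul_scaledDetail hn hν.ne',
    NormedSpace.normalize_smul_of_pos hscale, normalize_coe, map_add, Submodule.coe_inner]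

variable {Ω : Type*} [MeasurableSpace Ω] {P : Measure Ω} {ξ : Ω → Vec n}

lemma hasLaw_scaledDetail_noise (hn : n ≠ 0) (hν : 0 < ν) (hξ : HasLaw ξ (noiseLaw n ν) P) :
    HasLaw (fun ω ↦ scaledDetail n ν (ξ ω)) (stdGaussian (detailSubspace n)) P := by
  have hscale : ν / √n ≠ 0 := by positivity
  have hcomp : scaledDetail n ν ∘ (fun z ↦ (ν / √n) • z) =
      (detailSubspace n).orthogonalProjectionOnto := by
    ext1 z
    rw [Function.comp_apply, map_smul, scaledDetail, smul_apply,
      smul_inv_smul₀ hscale]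
  refine HasLaw.fun_comp ⟨by fun_prop, ?_⟩ hξ
  rw [noiseLaw_eq_map_stdGaussian hν.le, Measure.map_map (by fun_prop) (by fun_prop), hcomp,
    map_orthogonalProjectionOnto_stdGaussian]

lemma integral_norm_detailProj_noise (hn : n ≠ 0) (hν : 0 < ν)
    (hξ : HasLaw ξ (noiseLaw n ν) P) :
    ∫ ω, ‖detailProj n (ξ ω)‖ ∂P =
      ν / √n * ∫ z, ‖z‖ ∂(stdGaussian (detailSubspace n)) := by
  have hscale : 0 ≤ ν / √n := by positivity
  simp_rw [detailProj_eq_smul_scaledDetail hn hν.ne', norm_smul, Real.norm_of_nonneg hscale]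
  rw [integral_const_mul]
  congr 1
  exact (hasLaw_scaledDetail_noise hn hν hξ).integral_comp (f := fun z ↦ ‖z‖) (by fun_prop)

lemma norm_scaledDetail_act_le_snr_mul [Nontrivial (detailSubspace n)] (hn : n ≠ 0) (hν : 0 < ν)
    (hξ : HasLaw ξ (noiseLaw n ν) P) (M : Matrix (Fin n) (Fin n) ℝ) (x : Vec n) :
    ‖scaledDetail n ν (act M x)‖ ≤ snr P M x ξ * √(finrank ℝ (detailSubspace n)) := by
  have hmean := integral_norm_stdGaussian_pos (E := detailSubspace n)
  rw [snr, integral_norm_detailProj_noise hn hν hξ, ← div_div]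
  calc ‖scaledDetail n ν (act M x)‖ ≤ ‖act M x‖ / (ν / √n) := norm_scaledDetail_le hν.le _
    _ = ‖act M x‖ / (ν / √n) / (∫ z, ‖z‖ ∂(stdGaussian (detailSubspace n))) *
        ∫ z, ‖z‖ ∂(stdGaussian (detailSubspace n)) := (div_mul_cancel₀ _ hmean.ne').symm
    _ ≤ _ := by
        gcongr
        exact integral_norm_stdGaussian_le

end Model

end Collapse

open Collapse in
theorem mainTheorem1_general {n : ℕ} (hn : 2 ≤ n) (M M' : Matrix (Fin n) (Fin n) ℝ)
    (x x' : Vec n) {ν : ℝ} (hν : 0 < ν) {Ω : Type*} [MeasurableSpace Ω] {P : Measure Ω}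
    [IsProbabilityMeasure P] {ξ ξ' : Ω → Vec n} (hξ : HasLaw ξ (noiseLaw n ν) P)
    (hξ' : HasLaw ξ' (noiseLaw n ν) P) (hind : IndepFun ξ ξ' P) {ε : ℝ} (hε : 0 ≤ ε) :
    1 - 4 * Real.exp (-(1 / 16 * n * ε ^ 2)) ≤
      P.real {ω | |inner ℝ (normalizedOutput M x (ξ ω)) (normalizedOutput M' x' (ξ' ω))| ≤
        ε + 8 * max (snr P M x ξ) (snr P M' x' ξ')} := by
  have hn0 : n ≠ 0 := by positivity
  have hdim := finrank_detailSubspace_add_one hn0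
  have hdim_pos : 0 < Module.finrank ℝ (detailSubspace n) := by omega
  have : Nontrivial (detailSubspace n) := Module.nontrivial_of_finrank_pos hdim_pos
  have hdim_ge : (n : ℝ) / 2 ≤ Module.finrank ℝ (detailSubspace n) := by
    rify at hn hdim
    linarith
  have hlower := one_sub_le_measureReal_abs_inner_normalize_add_le
    (hasLaw_scaledDetail_noise hn0 hν hξ) (hasLaw_scaledDetail_noise hn0 hν hξ')
    (hind.comp (scaledDetail n ν).measurable (scaledDetail n ν).measurable) hε
    ((norm_scaledDetail_act_le_snr_mul hn0 hν hξ M x).trans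
      (mul_le_mul_of_nonneg_right (le_max_left _ _) (Real.sqrt_nonneg _)))
    ((norm_scaledDetail_act_le_snr_mul hn0 hν hξ' M' x').trans
      (mul_le_mul_of_nonneg_right (le_max_right _ _) (Real.sqrt_nonneg _)))
  simp_rw [inner_normalizedOutput_normalizedOutput hn0 hν]
  refine le_trans ?_ hlower
  gcongr
  nlinarith [sq_nonneg ε]

theorem mainTheorem1 :
    ∃ c C : ℝ, 0 < c ∧ 0 < C ∧
      ∀ (n : ℕ), 2 ≤ n →
      ∀ (M : Matrix (Fin n) (Fin n) ℝ), M ∈ doublyStochastic ℝ (Fin n) → M.IsPrimitive →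
      ∀ (x x' : Collapse.Vec n), x ∈ Collapse.detailSubspace n → x' ∈ Collapse.detailSubspace n →
      ∀ (ν : ℝ), 0 < ν →
      ∀ (Ω : Type*) [MeasurableSpace Ω] (P : Measure Ω) [IsProbabilityMeasure P]
        (ξ ξ' : Ω → Collapse.Vec n),
        HasLaw ξ (Collapse.noiseLaw n ν) P → HasLaw ξ' (Collapse.noiseLaw n ν) P →
        IndepFun ξ ξ' P →
      ∀ (γ : ℝ), γ = max (Collapse.snr P M x ξ) (Collapse.snr P M x' ξ') → γ ≤ 1 / 8 →
      ∀ (ε δ : ℝ), 0 < ε → δ ∈ Set.Ioo (0 : ℝ) 1 →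
        1 - δ - C * Real.exp (-(c * n * ε ^ 2)) ≤
          P.real {ω | |inner ℝ (Collapse.normalizedOutput M x (ξ ω))
            (Collapse.normalizedOutput M x' (ξ' ω))| ≤ ε + 8 * γ} := by
  refine ⟨1 / 16, 4, by norm_num, by norm_num, ?_⟩
  intro n hn M _ _ x x' _ _ ν hν Ω _ P _ ξ ξ' hξ hξ' hind γ hγ _ ε δ hε hδ
  rw [hγ]
  linarith [mainTheorem1_general hn M M x x' hν hξ hξ' hind hε.le, hδ.1]
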